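/- Throughout, $\log=\log_2$ and $H(p)=-p\log p-(1-p)\log(1-p)$ is the binary entropy function, with $0\cdot\log b=0$ and $\log 0=-\infty$; the expression $\frac{\log x}{x-1}$ is read as $\log e$ when $x=1$ and as $+\infty$ when $x=0$ (with $0\cdot(+\infty)=0$ and $-\infty+\infty=-\infty$). Let $G$ be a finite simple graph on a vertex set $V$ of size $N$, let $d_v$ be the degree of $v$, and let $\Phi_\ell(G)$ be the number of $\ell$-matchings of $G$, i.e. of sets of $\ell$ pairwise vertex-disjoint edges. For $W\subseteq V$ let $d_\ell(W)=\sum_{S\subseteq W,\,|S|=\ell}\ \prod_{v\in S}d_v$. (i) Suppose $G$ is bipartite with bipartition $V=X\cup Y$ and $0\le \ell\le\min\{|X|,|Y|\}$, and set $\delta_X=\min\{d_x:x\in X\}$ and $\alpha_Y=\ell/|Y|$ (with $\delta_X=0$ if $X=\emptyset$ and $\alpha_Y=0$ if $Y=\emptyset$). Then $$\log\Phi_\ell(G)\le \log d_\ell(X)+|Y|\left[H(\alpha_Y)+\alpha_Y\log\frac{\alpha_Y}{e}+\frac{\log\delta_X}{\delta_X-1}\right].$$ (ii) For a general $G$ with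 minimum degree $\delta$ (with $\delta=0$ if $V=\emptyset$), $0\le\ell\le N/2$ and $\alpha=2\ell/N$ (with $\alpha=0$ if $N=0$), $$\log\Phi_\ell(G)\le \tfrac12\log d_{2\ell}(V)+\frac N2\left[H(\alpha)+\alpha\log\frac{\alpha}{e}+\frac{\log\delta}{\delta-1}\right].$$ -/

import Mathlib

/-- Binary logarithm of a natural number, with values in `[-∞, ∞]` and `log₂ 0 = -∞`. -/
noncomputable def extLogTwo (n : ℕ) : EReal :=
  if n = 0 then ⊥ else ((Real.logb 2 (n : ℝ) : ℝ) : EReal)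

/-- `log₂ x / (x - 1)`, read as `log₂ e` at `x = 1`.
At `x = 0` this is `(-∞) / (-1) = +∞`. -/
noncomputable def logRatio (x : ℕ) : EReal :=
  if x = 1 then ((Real.logb 2 (Real.exp 1) : ℝ) : EReal)
  else extLogTwo x / (((x : ℝ) - 1 : ℝ) : EReal)

/-- The binary entropy function in bits (Mathlib's `Real.binEntropy` is in nats). -/
noncomputable def entropyTwo (p : ℝ) : ℝ :=
  Real.binEntropy p / Real.log 2

namespace SimpleGraph

/-- The number of `l`-matchings of `G`: sets of `l` pairwise vertex-disjoint edges. -/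
noncomputable def numMatchings {V : Type*} (G : SimpleGraph V) (l : ℕ) : ℕ :=
  {M : Finset (Sym2 V) | (M : Set (Sym2 V)) ⊆ G.edgeSet ∧ M.card = l ∧
    ∀ e ∈ M, ∀ f ∈ M, e ≠ f → ∀ v : V, v ∈ e → v ∉ f}.ncard

/-- The `l`-th elementary symmetric function of the degrees `d_v`, `v ∈ W`. -/
def degreeSymm {V : Type*} [Fintype V] (G : SimpleGraph V) [DecidableRel G.Adj]
    (l : ℕ) (W : Finset V) : ℕ :=
  ∑ S ∈ W.powersetCard l, ∏ v ∈ S, G.degree v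

/-- The minimum of the degrees `d_x`, `x ∈ X` (`0` if `X` is empty). -/
noncomputable def minDegreeOn {V : Type*} [Fintype V] (G : SimpleGraph V) [DecidableRel G.Adj]
    (X : Finset V) : ℕ :=
  sInf ((fun x => G.degree x) '' (X : Set V))

end SimpleGraph

/-!
Both parts are instances of one bound. A *partial injection* of size `l` with domain in `X` is a
set of `l` arcs `(v, w)`, `v ∈ X`, `w ∈ N v`, with distinct tails and distinct heads. In the
bipartite case the `l`-matchings, directed from `X` to `Y`, are partial injections. In the general
case a pair of `l`-matchings yields a partial injection of size `2 l` on `V`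
(`SimpleGraph.sq_numMatchings_le`): the union of two matchings is bipartite, and the edges of the
first are directed out of one colour class, those of the second out of the other; since the
colouring depends on the union alone, the pair can be recovered. So `Φ_l(G)²` is at most the number
of these partial injections, and part (ii) follows on halving the logarithms.

It remains to bound, for each domain `S` of size `l`, the number of injections `m` of `S` into a set
`T` of `n` points with `m x ∈ N x`, where `#(N x) = d_x ≥ δ`: with `α = l / n`, it is at most
`∏ d_x · exp (n (-(1 - α) log (1 - α) - α + log δ / (δ - 1)))` (`log_card_injections_le`). This is
an entropy argument in the manner of Radhakrishnan's proof of Brégman's theorem. Let `m` be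
uniformly random among these injections, with marginals `p_x`, and expose its values in random
order; equivalently, follow the mean entropy of the restriction of `m` to an `s`-random set `B` as
`s` goes from `0` to `1`. By the Margulis–Russo formula (`hasDerivAt_bernoulliMean`) its derivative
is the sum over `x` of the mean entropy of `m x` given `m` on `B`. Gibbs' inequality against `p_x`,
renormalised on the points unused by `B`, bounds this by `H(p_x)` plus the mean of the logarithm of
the `p_x`-mass of the unused points (`sum_log_agreeOn_le`). That mass has mean
`1 - s (a_x - c_x)`, where `a_x = ∑_z ∑_y p_x(y) p_z(y)` and `c_x = ∑_y p_x(y)²` is a collision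
probability. As `∑ a_x = ∑_y (∑_x p_x(y))² ≥ l α` by Cauchy–Schwarz, concavity of `log` gives
essentially `∑ H(p_x) + l log (1 - s α + s / δ)`, with an error linear in the `c_x - 1 / d_x`
(`sum_bernoulliMean_log_agreeOn_le`).

Integrating over `s`, the term `l log (1 - s α)` gives `n (-(1 - α) log (1 - α) - α)`; the shift
`s / δ` costs at most what it costs at `α = 1`, which is exactly `n log δ / (δ - 1)`
(`mul_log_one_sub_le`); and the collision error is exactly compensated by the entropy deficits
`log d_x - H(p_x)` (`entropy_add_collision_le`).
-/

/-! ### Means over random subsets -/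

section BernoulliMean

/-- The expectation of `f B`, where `B` is the random subset of `T` that contains each element
independently with probability `s`. It is a polynomial in `s`, meaningful for every real `s`. -/
noncomputable def bernoulliMean {ι : Type*} (T : Finset ι) (s : ℝ) (f : Finset ι → ℝ) : ℝ :=
  ∑ B ∈ T.powerset, s ^ B.card * (1 - s) ^ (T.card - B.card) * f B

variable {ι : Type*}

lemma bernoulliMean_empty (s : ℝ) (f : Finset ι → ℝ) : bernoulliMean ∅ s f = f ∅ := by
  simp [bernoulliMean]

lemma bernoulliMean_insert [DecidableEq ι] {T : Finset ι} {x : ι} (hx : x ∉ T) (s : ℝ)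
    (f : Finset ι → ℝ) :
    bernoulliMean (insert x T) s f =
      (1 - s) * bernoulliMean T s f + s * bernoulliMean T s (fun B => f (insert x B)) := by
  unfold bernoulliMean
  rw [Finset.sum_powerset_insert hx, Finset.mul_sum, Finset.mul_sum,
    Finset.card_insert_of_notMem hx]
  congr 1
  · refine Finset.sum_congr rfl fun B hB => ?_
    have h := Finset.card_le_card (Finset.mem_powerset.1 hB)
    rw [show T.card + 1 - B.card = (T.card - B.card) + 1 by omega, pow_succ]
    ring
  · refine Finset.sum_congr rfl fun B hB => ?_
    have h : x ∉ B := fun h => hx (Finset.mem_powerset.1 hB h)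
    rw [Finset.card_insert_of_notMem h, Nat.add_sub_add_right, pow_succ]
    ring

lemma bernoulliMean_sub (T : Finset ι) (s : ℝ) (f g : Finset ι → ℝ) :
    bernoulliMean T s (fun B => f B - g B) = bernoulliMean T s f - bernoulliMean T s g := by
  simp only [bernoulliMean, mul_sub, Finset.sum_sub_distrib]

lemma bernoulliMean_add (T : Finset ι) (s : ℝ) (f g : Finset ι → ℝ) :
    bernoulliMean T s (fun B => f B + g B) = bernoulliMean T s f + bernoulliMean T s g := by
  simp only [bernoulliMean, mul_add, Finset.sum_add_distrib]

lemma bernoulliMean_mul_left (T : Finset ι) (s c : ℝ) (f : Finset ι → ℝ) :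
    bernoulliMean T s (fun B => c * f B) = c * bernoulliMean T s f := by
  simp only [bernoulliMean, Finset.mul_sum]
  exact Finset.sum_congr rfl fun B _ => by ring

lemma bernoulliMean_sum {β : Type*} (T : Finset ι) (s : ℝ) (Ω : Finset β)
    (f : β → Finset ι → ℝ) :
    bernoulliMean T s (fun B => ∑ m ∈ Ω, f m B) = ∑ m ∈ Ω, bernoulliMean T s (f m) := by
  simp only [bernoulliMean, Finset.mul_sum]
  exact Finset.sum_comm

lemma bernoulliMean_const (T : Finset ι) (s c : ℝ) : bernoulliMean T s (fun _ => c) = c := by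
  classical
  induction T using Finset.induction_on with
  | empty => simp [bernoulliMean_empty]
  | insert x T hx ih => rw [bernoulliMean_insert hx, ih]; ring

lemma bernoulliMean_sum_mem (T : Finset ι) (s : ℝ) (g : ι → ℝ) :
    bernoulliMean T s (fun B => ∑ z ∈ B, g z) = s * ∑ z ∈ T, g z := by
  classical
  induction T using Finset.induction_on with
  | empty => simp [bernoulliMean_empty]
  | insert x T hx ih =>
    have h : bernoulliMean T s (fun B => ∑ z ∈ insert x B, g z) =
        bernoulliMean T s (fun B => g x + ∑ z ∈ B, g z) := by
      refine Finset.sum_congr rfl fun B hB => ?_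
      beta_reduce
      rw [Finset.sum_insert fun h => hx (Finset.mem_powerset.1 hB h)]
    rw [bernoulliMean_insert hx, ih, h, bernoulliMean_add, bernoulliMean_const, ih,
      Finset.sum_insert hx]
    ring

lemma bernoulliMean_mono {T : Finset ι} {s : ℝ} (h0 : 0 ≤ s) (h1 : s ≤ 1)
    {f g : Finset ι → ℝ} (h : ∀ B ⊆ T, f B ≤ g B) :
    bernoulliMean T s f ≤ bernoulliMean T s g := by
  refine Finset.sum_le_sum fun B hB => mul_le_mul_of_nonneg_left (h B (Finset.mem_powerset.1 hB)) ?_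
  have := sub_nonneg.2 h1
  positivity

lemma bernoulliMean_zero (T : Finset ι) (f : Finset ι → ℝ) : bernoulliMean T 0 f = f ∅ := by
  classical
  induction T using Finset.induction_on with
  | empty => simp [bernoulliMean_empty]
  | insert x T hx ih => rw [bernoulliMean_insert hx, ih]; ring

lemma bernoulliMean_one (T : Finset ι) (f : Finset ι → ℝ) : bernoulliMean T 1 f = f T := by
  classical
  induction T using Finset.induction_on generalizing f with
  | empty => simp [bernoulliMean_empty]
  | insert x T hx ih => rw [bernoulliMean_insert hx, ih, ih]; ring

/-- The Margulis–Russo formula. -/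
lemma hasDerivAt_bernoulliMean [DecidableEq ι] (T : Finset ι) (f : Finset ι → ℝ) (s : ℝ) :
    HasDerivAt (fun s => bernoulliMean T s f)
      (∑ x ∈ T, bernoulliMean (T.erase x) s (fun B => f (insert x B) - f B)) s := by
  induction T using Finset.induction_on generalizing f with
  | empty => simpa [bernoulliMean_empty] using hasDerivAt_const s (f ∅)
  | insert a T ha ih =>
    simp only [bernoulliMean_insert ha]
    have h1 : HasDerivAt (fun s : ℝ => 1 - s) (-1) s := by
      simpa using (hasDerivAt_id s).const_sub 1
    refine ((h1.mul (ih f)).add ((hasDerivAt_id s).mul (ih fun B => f (insert a B)))).congr_deriv ?_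
    rw [Finset.sum_insert ha, Finset.erase_insert ha]
    have h2 : ∀ x ∈ T, bernoulliMean ((insert a T).erase x) s (fun B => f (insert x B) - f B) =
        (1 - s) * bernoulliMean (T.erase x) s (fun B => f (insert x B) - f B) +
        s * bernoulliMean (T.erase x) s
          (fun B => f (insert a (insert x B)) - f (insert a B)) := by
      intro x hx
      have hne : a ≠ x := fun h => ha (h ▸ hx)
      rw [Finset.erase_insert_of_ne hne,
        bernoulliMean_insert fun h => ha (Finset.mem_of_mem_erase h)]
      simp only [Finset.insert_comm x a]
    rw [Finset.sum_congr rfl h2, Finset.sum_add_distrib, ← Finset.mul_sum, ← Finset.mul_sum,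
      bernoulliMean_sub]
    simp only [id]
    ring

end BernoulliMean

/-! ### Integrals and entropy deficits -/

section Calculus

open Real

lemma hasDerivAt_log_primitive {u s : ℝ} (hu : u ≠ 0) (h : 0 < 1 - s * u) :
    HasDerivAt (fun s => -((1 - s * u) * log (1 - s * u)) / u - s) (log (1 - s * u)) s := by
  have h1 : HasDerivAt (fun s : ℝ => 1 - s * u) (-u) s := by
    simpa using ((hasDerivAt_id s).mul_const u).const_sub 1
  have h2 := ((((hasDerivAt_mul_log h.ne').comp s h1).neg).div_const u).sub (hasDerivAt_id s)
  refine h2.congr_deriv ?_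
  field_simp
  ring

lemma continuous_log_primitive (u : ℝ) :
    Continuous (fun s : ℝ => -((1 - s * u) * log (1 - s * u)) / u - s) := by
  have h : Continuous (fun s : ℝ => (1 - s * u) * log (1 - s * u)) :=
    continuous_mul_log.comp (by fun_prop : Continuous fun s : ℝ => 1 - s * u)
  exact (h.neg.div_const u).sub continuous_id

lemma hasDerivAt_ratio_primitive {r s : ℝ} (hr : r ≠ 1) (h : 0 < r - s * (r - 1)) :
    HasDerivAt (fun s => -s / (r - 1) - r * log (r - s * (r - 1)) / (r - 1) ^ 2)
      (s / (r - s * (r - 1))) s := by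
  have hr' : r - 1 ≠ 0 := sub_ne_zero.2 hr
  have h1 : HasDerivAt (fun s : ℝ => r - s * (r - 1)) (-(r - 1)) s := by
    simpa using ((hasDerivAt_id s).mul_const (r - 1)).const_sub r
  have h2 := (((hasDerivAt_id s).neg).div_const (r - 1)).sub
    (((h1.log h.ne').const_mul r).div_const ((r - 1) ^ 2))
  refine h2.congr_deriv ?_
  obtain ⟨D, hD⟩ : ∃ D, D = r - s * (r - 1) := ⟨_, rfl⟩
  rw [← hD] at h ⊢
  have := h.ne'
  field_simp
  rw [hD]
  ring

/-- The derivative is only needed inside the interval, where the primitives in use are smooth; at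
`s = 1` some of them are merely continuous. -/
lemma le_of_hasDerivAt_nonpos {f f' : ℝ → ℝ} (hc : ContinuousOn f (Set.Icc 0 1))
    (hd : ∀ s, 0 < s → s < 1 → HasDerivAt f (f' s) s) (h : ∀ s, 0 < s → s < 1 → f' s ≤ 0) :
    f 1 ≤ f 0 := by
  have : AntitoneOn f (Set.Icc 0 1) := by
    refine antitoneOn_of_deriv_nonpos (convex_Icc 0 1) hc ?_ ?_
    · rw [interior_Icc]
      exact fun s hs => (hd s hs.1 hs.2).differentiableAt.differentiableWithinAt
    · rw [interior_Icc]
      exact fun s hs => (hd s hs.1 hs.2).deriv ▸ h s hs.1 hs.2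
  exact this (by simp) (by simp) zero_le_one

/-- The quotient `(r log r - r + 1) / (r - 1)²` is the integral of `s / (r - s (r - 1))` over
`0 ≤ s ≤ 1`, whence it decreases with `r`. -/
lemma mul_sq_le_mul_log {r d : ℝ} (hr : 0 ≤ r) (hd : 1 < d) (hrd : r ≤ d) :
    (d * log d - d + 1) / (d - 1) ^ 2 * (r - 1) ^ 2 ≤ r * log r - r + 1 := by
  rcases eq_or_ne r 1 with rfl | hr1
  · simp
  have hpos : ∀ x : ℝ, 0 ≤ x → ∀ s : ℝ, 0 < s → s ≤ 1 → 0 < x - s * (x - 1) := by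
    intro x hx s h0 h1
    nlinarith [mul_nonneg hx (sub_nonneg.2 h1)]
  have hr1' : r - 1 ≠ 0 := sub_ne_zero.2 hr1
  have hd1' : d - 1 ≠ 0 := sub_ne_zero.2 hd.ne'
  have hcont : ∀ x : ℝ, 0 ≤ x → ContinuousOn
      (fun s : ℝ => -s / (x - 1) - x * log (x - s * (x - 1)) / (x - 1) ^ 2) (Set.Icc 0 1) := by
    intro x hx
    rcases hx.eq_or_lt with rfl | hx
    · simp only [zero_mul, zero_div, sub_zero]
      fun_prop
    refine ContinuousOn.sub (by fun_prop) (ContinuousOn.div_const (ContinuousOn.mul (by fun_prop)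
      (ContinuousOn.log (by fun_prop) fun s hs => ?_)) _)
    rcases hs.1.eq_or_lt with rfl | h0
    · simpa using hx.ne'
    · exact (hpos x hx.le s h0 hs.2).ne'
  have key := le_of_hasDerivAt_nonpos ((hcont d (by linarith)).sub (hcont r hr))
    (fun s h0 h1 => (hasDerivAt_ratio_primitive hd.ne' (hpos d (by linarith) s h0 h1.le)).sub
      (hasDerivAt_ratio_primitive hr1 (hpos r hr s h0 h1.le)))
    (fun s h0 h1 => by
      refine sub_nonpos.2 (div_le_div_of_nonneg_left h0.le (hpos r hr s h0 h1.le) ?_)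
      nlinarith)
  have e : ∀ x : ℝ, x - 1 ≠ 0 → (x * log x - x + 1) / (x - 1) ^ 2 =
      -1 / (x - 1) - -(x * log x / (x - 1) ^ 2) := by
    intro x hx
    field_simp
    ring
  have h2 : (d * log d - d + 1) / (d - 1) ^ 2 ≤ (r * log r - r + 1) / (r - 1) ^ 2 := by
    rw [e d hd1', e r hr1']
    simp only [Pi.sub_apply] at key
    simp only [one_mul, sub_sub_cancel, log_one, mul_zero, zero_div, zero_mul, sub_zero, neg_zero,
    zero_sub] at key
    linarith
  rwa [le_div_iff₀ (by positivity)] at h2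

/-- A lower bound for the entropy deficit `log d - H(p)` of a distribution `p` on `d` points in
terms of its collision probability `∑ p²`: `mul_sq_le_mul_log` at `r = d p`, summed. Its factor
`d (d log d - d + 1) / (d - 1)²` is the integral of `s / (1 - s + s / d)` over `0 ≤ s ≤ 1`. -/
lemma entropy_add_collision_le {κ : Type*} (N : Finset κ) (p : κ → ℝ) (hN : 1 < N.card)
    (h0 : ∀ y ∈ N, 0 ≤ p y) (hp : ∑ y ∈ N, p y = 1) :
    -∑ y ∈ N, p y * log (p y) + (∑ y ∈ N, p y ^ 2 - 1 / N.card) *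
      (N.card * ((N.card * log N.card - N.card + 1) / (N.card - 1) ^ 2)) ≤ log N.card := by
  set d : ℝ := (N.card : ℝ) with hd
  have hd1 : 1 < d := by rw [hd]; exact_mod_cast hN
  set k : ℝ := (d * log d - d + 1) / (d - 1) ^ 2 with hk
  have hterm : ∀ y ∈ N, k * (d * p y - 1) ^ 2 ≤ d * (p y * log (p y)) + d * log d * p y
      - d * p y + 1 := by
    intro y hy
    have hle : p y ≤ 1 := hp ▸ Finset.single_le_sum h0 hy
    have := mul_sq_le_mul_log (r := d * p y) (by have := h0 y hy; positivity) hd1 (by nlinarith)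
    refine this.trans (le_of_eq ?_)
    rcases (h0 y hy).eq_or_lt with h | h
    · simp [← h]
    · rw [log_mul (by positivity) h.ne']
      ring
  have hsum := Finset.sum_le_sum hterm
  have e1 : ∑ y ∈ N, k * (d * p y - 1) ^ 2 = k * (d ^ 2 * ∑ y ∈ N, p y ^ 2 - d) := by
    rw [← Finset.mul_sum]
    congr 1
    have : ∀ y ∈ N, (d * p y - 1) ^ 2 = d ^ 2 * p y ^ 2 - 2 * d * p y + 1 := fun y _ => by ring
    rw [Finset.sum_congr rfl this, Finset.sum_add_distrib, Finset.sum_sub_distrib,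
      ← Finset.mul_sum, ← Finset.mul_sum, hp]
    simp only [Finset.sum_const, nsmul_eq_mul, mul_one, ← hd]
    ring
  have e2 : ∑ y ∈ N, (d * (p y * log (p y)) + d * log d * p y - d * p y + 1) =
      d * ∑ y ∈ N, p y * log (p y) + d * log d := by
    rw [Finset.sum_add_distrib, Finset.sum_sub_distrib, Finset.sum_add_distrib,
      ← Finset.mul_sum, ← Finset.mul_sum, ← Finset.mul_sum, hp]
    simp only [Finset.sum_const, nsmul_eq_mul, mul_one, ← hd]
    ring
  rw [e1, e2] at hsum
  have hd0 : 0 < d := by linarith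
  have e3 : (∑ y ∈ N, p y ^ 2 - 1 / d) * (d * k) = k * (d ^ 2 * ∑ y ∈ N, p y ^ 2 - d) / d := by
    field_simp
  rw [e3]
  have := (div_le_div_iff_of_pos_right hd0).2 hsum
  rw [show (d * ∑ y ∈ N, p y * log (p y) + d * log d) / d = ∑ y ∈ N, p y * log (p y) + log d by
    field_simp] at this
  linarith

end Calculus

/-! ### Conditional entropies of random injections -/

section Entropy

open Real

variable {ι κ : Type*} [DecidableEq κ]

/-- The members of `Ω` that agree with `m` on `B`. -/
def agreeOn [DecidableEq ι] (Ω : Finset (ι → κ)) (B : Finset ι) (m : ι → κ) : Finset (ι → κ) :=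
  Ω.filter fun m' => ∀ i ∈ B, m' i = m i

/-- The probability that a uniformly random member of `Ω` sends `i` to `y` (`0` if `Ω` is empty). -/
noncomputable def marginal (Ω : Finset (ι → κ)) (i : ι) (y : κ) : ℝ :=
  ((Ω.filter fun m => m i = y).card : ℝ) / Ω.card

lemma marginal_nonneg (Ω : Finset (ι → κ)) (i : ι) (y : κ) : 0 ≤ marginal Ω i y := by
  unfold marginal; positivity

lemma marginal_pos {Ω : Finset (ι → κ)} {m : ι → κ} (hm : m ∈ Ω) (i : ι) :
    0 < marginal Ω i (m i) := by
  have h1 : 0 < (Ω.filter fun m' => m' i = m i).card := Finset.card_pos.2 ⟨m, by simp [hm]⟩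
  have h2 : 0 < Ω.card := Finset.card_pos.2 ⟨m, hm⟩
  unfold marginal
  positivity

lemma sum_apply_eq_marginal {Ω : Finset (ι → κ)} (hΩ : Ω.Nonempty) {i : ι} {T : Finset κ}
    (hT : ∀ m ∈ Ω, m i ∈ T) (g : κ → ℝ) :
    ∑ m ∈ Ω, g (m i) = Ω.card * ∑ y ∈ T, marginal Ω i y * g y := by
  have h : (Ω.card : ℝ) ≠ 0 := by exact_mod_cast hΩ.card_pos.ne'
  rw [← Finset.sum_fiberwise_of_maps_to hT, Finset.mul_sum]
  refine Finset.sum_congr rfl fun y _ => ?_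
  rw [Finset.sum_congr rfl fun m hm => by rw [(Finset.mem_filter.1 hm).2], Finset.sum_const,
    nsmul_eq_mul, marginal]
  field_simp

lemma sum_marginal {Ω : Finset (ι → κ)} (hΩ : Ω.Nonempty) {i : ι} {T : Finset κ}
    (hT : ∀ m ∈ Ω, m i ∈ T) : ∑ y ∈ T, marginal Ω i y = 1 := by
  have h : (Ω.card : ℝ) ≠ 0 := by exact_mod_cast hΩ.card_pos.ne'
  have := sum_apply_eq_marginal hΩ hT fun _ => 1
  simp only [Finset.sum_const, nsmul_eq_mul, mul_one] at this
  exact (mul_left_cancel₀ h (by rw [← this, mul_one]))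

variable [DecidableEq ι]

/-- Gibbs' inequality for the value `m x`, given the values of `m` on `B`, against the distribution
proportional to `w` on the points that `m` has not used on `B`. -/
lemma sum_log_agreeOn_le {Ω : Finset (ι → κ)} (hinj : ∀ m ∈ Ω, Function.Injective m)
    {T : Finset κ} (hT : ∀ m ∈ Ω, ∀ i, m i ∈ T) {w : κ → ℝ} (hw0 : ∀ y, 0 ≤ w y)
    (hw1 : ∑ y ∈ T, w y = 1) {x : ι} (hw : ∀ m ∈ Ω, 0 < w (m x)) {B : Finset ι} (hx : x ∉ B) :
    ∑ m ∈ Ω, (log (agreeOn Ω B m).card - log (agreeOn Ω (insert x B) m).card) ≤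
      ∑ m ∈ Ω, (log (1 - ∑ z ∈ B, w (m z)) - log (w (m x))) := by
  set A : (ι → κ) → ℝ := fun m => 1 - ∑ z ∈ B, w (m z) with hA
  have hcl : ∀ (C : Finset ι), ∀ m ∈ Ω, (0 : ℝ) < (agreeOn Ω C m).card := fun C m hm => by
    exact_mod_cast Finset.card_pos.2 ⟨m, by simp [agreeOn, hm]⟩
  have hAeq : ∀ m ∈ Ω, ∑ y ∈ T \ B.image m, w y = A m := by
    intro m hm
    have hsub : B.image m ⊆ T := Finset.image_subset_iff.2 fun z _ => hT m hm z
    rw [hA, ← hw1, ← Finset.sum_sdiff hsub, Finset.sum_image (fun _ _ _ _ h => hinj m hm h)]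
    ring
  have hmem : ∀ m ∈ Ω, m x ∈ T \ B.image m := fun m hm => by
    simp only [Finset.mem_sdiff, Finset.mem_image, not_exists, not_and]
    exact ⟨hT m hm x, fun z hz h => hx (hinj m hm h ▸ hz)⟩
  have hApos : ∀ m ∈ Ω, 0 < A m := fun m hm => by
    rw [← hAeq m hm]
    exact (hw m hm).trans_le (Finset.single_le_sum (fun y _ => hw0 y) (hmem m hm))
  set term : (ι → κ) → ℝ := fun m =>
    (agreeOn Ω B m).card * (w (m x) / ((agreeOn Ω (insert x B) m).card * A m)) with hterm
  have hlog : ∀ m ∈ Ω, (log (agreeOn Ω B m).card - log (agreeOn Ω (insert x B) m).card) -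
      (log (A m) - log (w (m x))) ≤ term m - 1 := by
    intro m hm
    have h1 := hcl B m hm
    have h2 := hcl (insert x B) m hm
    have h3 := hApos m hm
    have h4 := hw m hm
    refine le_trans (le_of_eq ?_) (log_le_sub_one_of_pos (x := term m) (by positivity))
    rw [hterm, log_mul h1.ne' (by positivity), log_div h4.ne' (by positivity),
      log_mul h2.ne' h3.ne']
    ring
  have htot : ∑ m ∈ Ω, term m ≤ Ω.card := by
    -- Spread the factor `#(agreeOn Ω B m)` over the `m'` that agree with `m` on `B`; the inner sum
    -- over `m` then runs over one class of agreement on `B`, split by the value at `x`.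
    have e1 : ∑ m ∈ Ω, term m = ∑ m' ∈ Ω, ∑ m ∈ agreeOn Ω B m',
        w (m x) / ((agreeOn Ω (insert x B) m).card * A m) := by
      rw [Finset.sum_comm' (t' := Ω) (s' := fun m => agreeOn Ω B m)]
      · exact Finset.sum_congr rfl fun m _ => by rw [Finset.sum_const, nsmul_eq_mul]
      · intro m' m
        simp only [agreeOn, Finset.mem_filter]
        constructor
        · rintro ⟨h1, h2, h3⟩; exact ⟨⟨h1, fun i hi => (h3 i hi).symm⟩, h2⟩
        · rintro ⟨⟨h1, h3⟩, h2⟩; exact ⟨h1, h2, fun i hi => (h3 i hi).symm⟩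
    rw [e1, ← nsmul_one, ← Finset.sum_const]
    refine Finset.sum_le_sum fun m' hm' => ?_
    have hAm : ∀ m ∈ agreeOn Ω B m', A m = A m' := by
      intro m hm
      simp only [hA]
      congr 1
      exact Finset.sum_congr rfl fun z hz => by rw [(Finset.mem_filter.1 hm).2 z hz]
    have hmaps : ∀ m ∈ agreeOn Ω B m', m x ∈ T \ B.image m' := by
      intro m hm
      obtain ⟨h1, h2⟩ := Finset.mem_filter.1 hm
      have := hmem m h1
      rwa [Finset.image_congr fun i hi => h2 i hi] at this
    rw [← Finset.sum_fiberwise_of_maps_to hmaps]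
    have hfib : ∀ y ∈ T \ B.image m', ∑ m ∈ agreeOn Ω B m' with m x = y,
        w (m x) / ((agreeOn Ω (insert x B) m).card * A m) ≤ w y / A m' := by
      intro y _
      rcases (Finset.filter (fun m => m x = y) (agreeOn Ω B m')).eq_empty_or_nonempty with h | h
      · rw [h, Finset.sum_empty]
        exact div_nonneg (hw0 y) (hApos m' hm').le
      have hval : ∀ m ∈ Finset.filter (fun m => m x = y) (agreeOn Ω B m'),
          w (m x) / ((agreeOn Ω (insert x B) m).card * A m) =
          w y / ((Finset.filter (fun m => m x = y) (agreeOn Ω B m')).card * A m') := by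
        intro m hm
        obtain ⟨h1, h2⟩ := Finset.mem_filter.1 hm
        have h3 : agreeOn Ω (insert x B) m =
            Finset.filter (fun m => m x = y) (agreeOn Ω B m') := by
          have h4 := (Finset.mem_filter.1 h1).2
          ext n
          simp only [agreeOn, Finset.mem_filter, Finset.forall_mem_insert, h2]
          constructor
          · rintro ⟨g1, g2, g3⟩; exact ⟨⟨g1, fun i hi => (g3 i hi).trans (h4 i hi)⟩, g2⟩
          · rintro ⟨⟨g1, g3⟩, g2⟩; exact ⟨g1, g2, fun i hi => (g3 i hi).trans (h4 i hi).symm⟩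
        rw [h2, h3, hAm m h1]
      rw [Finset.sum_congr rfl hval, Finset.sum_const, nsmul_eq_mul]
      have hc : (0 : ℝ) < (Finset.filter (fun m => m x = y) (agreeOn Ω B m')).card := by
        exact_mod_cast Finset.card_pos.2 h
      have := hApos m' hm'
      exact le_of_eq (by field_simp)
    refine (Finset.sum_le_sum hfib).trans ?_
    rw [← Finset.sum_div, hAeq m' hm', div_self (hApos m' hm').ne']
  have := Finset.sum_le_sum hlog
  rw [Finset.sum_sub_distrib, Finset.sum_sub_distrib (f := term), Finset.sum_const, nsmul_one]
    at this
  linarith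

/-- The mean, over the `s`-random set `B`, of the conditional entropy of `m x` given `m` on `B`
(times `#Ω`). Concavity of `log` enters as `log a ≤ log t + a / t - 1`, for a `t` left free. -/
lemma bernoulliMean_log_agreeOn_le [Fintype ι] {Ω : Finset (ι → κ)} (hΩ : Ω.Nonempty)
    (hinj : ∀ m ∈ Ω, Function.Injective m) {T : Finset κ} (hT : ∀ m ∈ Ω, ∀ i, m i ∈ T)
    {s t : ℝ} (h0 : 0 ≤ s) (h1 : s ≤ 1) (ht : 0 < t) (x : ι) :
    bernoulliMean (Finset.univ.erase x) s (fun B => ∑ m ∈ Ω,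
      (log (agreeOn Ω B m).card - log (agreeOn Ω (insert x B) m).card)) ≤
    Ω.card * (log t - 1 + (1 - s * (∑ z, ∑ y ∈ T, marginal Ω x y * marginal Ω z y -
      ∑ y ∈ T, marginal Ω x y ^ 2)) / t - ∑ y ∈ T, marginal Ω x y * log (marginal Ω x y)) := by
  have hw1 := sum_marginal hΩ (i := x) fun m hm => hT m hm x
  have hstep : ∀ B ⊆ Finset.univ.erase x, ∑ m ∈ Ω,
      (log (agreeOn Ω B m).card - log (agreeOn Ω (insert x B) m).card) ≤
      ∑ m ∈ Ω, ((log t - 1 + 1 / t - log (marginal Ω x (m x))) -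
        t⁻¹ * ∑ z ∈ B, marginal Ω x (m z)) := by
    intro B hB
    have hx : x ∉ B := fun h => (Finset.mem_erase.1 (hB h)).1 rfl
    refine (sum_log_agreeOn_le hinj hT (marginal_nonneg Ω x) hw1
      (fun m hm => marginal_pos hm x) hx).trans (Finset.sum_le_sum fun m hm => ?_)
    have hpos : 0 < 1 - ∑ z ∈ B, marginal Ω x (m z) := by
      have hsub : (insert x B).image m ⊆ T := Finset.image_subset_iff.2 fun z _ => hT m hm z
      have := Finset.sum_le_sum_of_subset_of_nonneg hsub fun y _ _ => marginal_nonneg Ω x y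
      rw [hw1, Finset.sum_image (fun _ _ _ _ h => hinj m hm h), Finset.sum_insert hx] at this
      linarith [marginal_pos hm x]
    have := log_le_sub_one_of_pos (div_pos hpos ht)
    rw [log_div hpos.ne' ht.ne'] at this
    have e : (1 - ∑ z ∈ B, marginal Ω x (m z)) / t =
      1 / t - t⁻¹ * ∑ z ∈ B, marginal Ω x (m z) := by ring
    rw [e] at this
    linarith
  refine (bernoulliMean_mono h0 h1 hstep).trans (le_of_eq ?_)
  rw [bernoulliMean_sum]
  simp only [bernoulliMean_sub, bernoulliMean_const, bernoulliMean_mul_left, bernoulliMean_sum_mem]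
  have e1 : ∑ m ∈ Ω, ∑ z ∈ Finset.univ.erase x, marginal Ω x (m z) =
      Ω.card * (∑ z, ∑ y ∈ T, marginal Ω x y * marginal Ω z y -
      ∑ y ∈ T, marginal Ω x y ^ 2) := by
    rw [Finset.sum_comm, ← Finset.add_sum_erase Finset.univ _ (Finset.mem_univ x)]
    simp only [pow_two, add_sub_cancel_left]
    rw [Finset.mul_sum]
    refine Finset.sum_congr rfl fun z _ => ?_
    rw [sum_apply_eq_marginal hΩ (fun m hm => hT m hm z)]
    simp only [mul_comm]
  have e2 := sum_apply_eq_marginal hΩ (fun m hm => hT m hm x) fun y => log (marginal Ω x y)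
  rw [Finset.sum_sub_distrib, Finset.sum_sub_distrib, ← Finset.mul_sum, ← Finset.mul_sum, e1, e2,
    Finset.sum_const, nsmul_eq_mul]
  field_simp
  ring

/-- The derivative of the mean entropy of the restriction of a random `m ∈ Ω` to an `s`-random
set: the entropies of the marginals, a term in `s` alone, and a collision correction. -/
lemma sum_bernoulliMean_log_agreeOn_le [Fintype ι] {Ω : Finset (ι → κ)} (hΩ : Ω.Nonempty)
    (hinj : ∀ m ∈ Ω, Function.Injective m) {T : Finset κ} (hT : ∀ m ∈ Ω, ∀ i, m i ∈ T)
    {s α e : ℝ} (h0 : 0 ≤ s) (h1 : s ≤ 1) (hα : Fintype.card ι = α * T.card)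
    (ht : 0 < 1 - s * α + s * e) :
    ∑ x, bernoulliMean (Finset.univ.erase x) s (fun B => ∑ m ∈ Ω,
      (log (agreeOn Ω B m).card - log (agreeOn Ω (insert x B) m).card)) ≤
    Ω.card * (∑ x, -∑ y ∈ T, marginal Ω x y * log (marginal Ω x y) +
      Fintype.card ι * log (1 - s * α + s * e) +
      ∑ x, (∑ y ∈ T, marginal Ω x y ^ 2 - e) * (s / (1 - s * α + s * e))) := by
  set t := 1 - s * α + s * e with htdef
  refine (Finset.sum_le_sum fun x _ => bernoulliMean_log_agreeOn_le hΩ hinj hT h0 h1 ht x).trans ?_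
  rw [← Finset.mul_sum]
  refine mul_le_mul_of_nonneg_left ?_ (Nat.cast_nonneg _)
  -- The sum of the squares of the hitting probabilities of the points of `T` is at least `l² / n`.
  have hcs : Fintype.card ι * α ≤ ∑ x, ∑ z, ∑ y ∈ T, marginal Ω x y * marginal Ω z y := by
    have e1 : ∑ x, ∑ z, ∑ y ∈ T, marginal Ω x y * marginal Ω z y =
        ∑ y ∈ T, (∑ x, marginal Ω x y) ^ 2 := by
      simp only [pow_two, Finset.sum_mul_sum]
      rw [Finset.sum_comm (s := T)]
      exact Finset.sum_congr rfl fun x _ => Finset.sum_comm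
    have e2 : ∑ y ∈ T, ∑ x, marginal Ω x y = Fintype.card ι := by
      rw [Finset.sum_comm, Finset.sum_congr rfl fun x _ => sum_marginal hΩ fun m hm => hT m hm x]
      simp
    have e3 := sq_sum_le_card_mul_sum_sq (s := T) (f := fun y => ∑ x, marginal Ω x y)
    rw [e2] at e3
    rw [e1]
    rcases T.eq_empty_or_nonempty with h | h
    · simp [hα, h]
    have hTpos : (0 : ℝ) < T.card := by exact_mod_cast h.card_pos
    refine le_of_mul_le_mul_left ?_ hTpos
    calc (T.card : ℝ) * (Fintype.card ι * α) = (Fintype.card ι : ℝ) ^ 2 := by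
          rw [pow_two]; nth_rewrite 3 [hα]; ring
      _ ≤ _ := e3
  simp only [Finset.sum_sub_distrib, Finset.sum_add_distrib, ← Finset.sum_div, ← Finset.mul_sum,
    ← Finset.sum_mul, Finset.sum_neg_distrib]
  simp only [Finset.sum_const, Finset.card_univ, nsmul_eq_mul, mul_one]
  set l : ℝ := (Fintype.card ι : ℝ)
  set S1 := ∑ x, ∑ z, ∑ y ∈ T, marginal Ω x y * marginal Ω z y
  set S2 := ∑ x, ∑ y ∈ T, marginal Ω x y ^ 2
  have h2 : (l - s * (S1 - S2)) / t ≤ l + (S2 - l * e) * (s / t) := by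
    rw [div_le_iff₀ ht]
    have : (l + (S2 - l * e) * (s / t)) * t = l * t + (S2 - l * e) * s := by
      field_simp
    rw [this, htdef]
    nlinarith [mul_le_mul_of_nonneg_left hcs h0]
  linarith

end Entropy

/-! ### The entropy bound -/

section Injections

open Real

variable {ι κ : Type*} [DecidableEq κ]

/-- The function `u ↦ log (1 - s u + s e) - log (1 - s u)` increases, so that `α` times its value at
`α ≤ 1` is at most its value at `1`. -/
lemma mul_log_one_sub_le {l n α s e : ℝ} (hn : 0 ≤ n) (hα : l = α * n) (hα1 : α ≤ 1)
    (hs0 : 0 < s) (hs1 : s < 1) (he : 0 ≤ e) :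
    l * log (1 - s * α + s * e) ≤ l * log (1 - s * α) +
      n * (log (1 - s * (1 - e)) - log (1 - s * 1)) := by
  have h1 : 0 < 1 - s := by linarith
  have hsα : s * α ≤ s := by nlinarith
  have h2 : 0 < 1 - s * α := by linarith
  have hse : 0 ≤ s * e := by positivity
  have e1 : log (1 - s * α + s * e) - log (1 - s * α) = log (1 + s * e / (1 - s * α)) := by
    rw [← log_div (by positivity) h2.ne']
    congr 1
    field_simp
  have e2 : log (1 - s * (1 - e)) - log (1 - s * 1) = log (1 + s * e / (1 - s)) := by
    rw [mul_one, ← log_div (by nlinarith) h1.ne']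
    congr 1
    field_simp
    ring
  have h3 : log (1 + s * e / (1 - s * α)) ≤ log (1 + s * e / (1 - s)) := by
    refine log_le_log (by positivity) (by gcongr)
  have h4 : 0 ≤ log (1 + s * e / (1 - s * α)) :=
    log_nonneg (by have : 0 ≤ s * e / (1 - s * α) := by positivity
                   linarith)
  rw [e2]
  have h5 : α * log (1 + s * e / (1 - s * α)) ≤ log (1 + s * e / (1 - s)) := by nlinarith
  have h6 := mul_le_mul_of_nonneg_left h5 hn
  have : l * log (1 - s * α + s * e) - l * log (1 - s * α) =
      n * (α * log (1 + s * e / (1 - s * α))) := by rw [← mul_sub, e1, hα]; ring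
  linarith

/-- The error term with the common parameters `α` and `e = 1 / δ`, compared with one that depends
on the degree `d` alone and integrates to the factor of `entropy_add_collision_le`. -/
lemma collision_mul_le {c e d s α : ℝ} (hs0 : 0 < s) (hs1 : s < 1) (hα1 : α ≤ 1) (hd : 1 < d)
    (hde : 1 / d ≤ e) (hc : 1 / d ≤ c) :
    (c - e) * (s / (1 - s * α + s * e)) ≤ (c - 1 / d) * (d * (s / (d - s * (d - 1)))) := by
  have hd0 : 0 < d := by linarith
  have hdpos : 0 < 1 / d := by positivity
  have h0 : 0 < 1 - s + s * (1 / d) := by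
    have : 0 < s * (1 / d) := by positivity
    linarith
  have h1 : d * (s / (d - s * (d - 1))) = s / (1 - s + s * (1 / d)) := by
    have : d - s * (d - 1) = d * (1 - s + s * (1 / d)) := by field_simp; ring
    rw [this]
    field_simp
  rw [h1]
  have h2 : 1 - s + s * (1 / d) ≤ 1 - s * α + s * e := by nlinarith
  calc (c - e) * (s / (1 - s * α + s * e)) ≤ (c - 1 / d) * (s / (1 - s * α + s * e)) := by
        refine mul_le_mul_of_nonneg_right (by linarith) (div_nonneg hs0.le (by linarith))
    _ ≤ _ := mul_le_mul_of_nonneg_left (div_le_div_of_nonneg_left hs0.le h0 h2) (by linarith)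

lemma marginal_eq_zero {Ω : Finset (ι → κ)} {i : ι} {y : κ} (h : ∀ m ∈ Ω, m i ≠ y) :
    marginal Ω i y = 0 := by
  rw [marginal, Finset.filter_false_of_mem h]
  simp

variable [DecidableEq ι] [Fintype ι]

/-- The entropy bound for a family `Ω` of injective choice functions of sets `N i` of size at
least `δ`: with `n = #T` and `α = #ι / n`,
`log #Ω ≤ ∑ log #(N i) + n (-(1 - α) log (1 - α) - α + log δ / (δ - 1))`. -/
theorem log_card_injections_le {Ω : Finset (ι → κ)} (hΩ : Ω.Nonempty)
    (hinj : ∀ m ∈ Ω, Function.Injective m) {T : Finset κ} {N : ι → Finset κ}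
    (hNT : ∀ i, N i ⊆ T) (hΩN : ∀ m ∈ Ω, ∀ i, m i ∈ N i) {δ : ℕ} (hδ : 2 ≤ δ)
    (hd : ∀ i, δ ≤ (N i).card) (hι : 0 < Fintype.card ι) {α : ℝ}
    (hα : α = Fintype.card ι / T.card) :
    log Ω.card ≤ ∑ i, log (N i).card +
      T.card * (-((1 - α) * log (1 - α)) - α + log δ / (δ - 1)) := by
  have hT : ∀ m ∈ Ω, ∀ i, m i ∈ T := fun m hm i => hNT i (hΩN m hm i)
  have hle : Fintype.card ι ≤ T.card := by
    obtain ⟨m, hm⟩ := hΩ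
    exact Finset.card_le_card_of_injOn (s := Finset.univ) m (fun i _ => hT m hm i)
      (hinj m hm).injOn
  have hT0 : (0 : ℝ) < T.card := by exact_mod_cast hι.trans_le hle
  have hl0 : (0 : ℝ) < Fintype.card ι := by exact_mod_cast hι
  have hle' : (Fintype.card ι : ℝ) ≤ T.card := by exact_mod_cast hle
  have hα0 : 0 < α := by rw [hα]; positivity
  have hα1 : α ≤ 1 := by rw [hα]; exact div_le_one_of_le₀ hle' hT0.le
  have hlα : (Fintype.card ι : ℝ) = α * T.card := by rw [hα]; field_simp
  have hΩ0 : (0 : ℝ) < Ω.card := by exact_mod_cast hΩ.card_pos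
  have hδ1 : (1 : ℝ) < δ := by exact_mod_cast hδ
  have hd1 : ∀ i, (1 : ℝ) < (N i).card := fun i => by exact_mod_cast hδ.trans (hd i)
  have hde : ∀ i, 1 / ((N i).card : ℝ) ≤ 1 / (δ : ℝ) := fun i =>
    one_div_le_one_div_of_le (by linarith) (by exact_mod_cast hd i)
  have hp1 : ∀ i, ∑ y ∈ N i, marginal Ω i y = 1 := fun i =>
    sum_marginal hΩ fun m hm => hΩN m hm i
  have hsupp : ∀ i, ∀ y ∈ T, y ∉ N i → marginal Ω i y = 0 := fun i y _ hy =>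
    marginal_eq_zero fun m hm h => hy (h ▸ hΩN m hm i)
  set c : ι → ℝ := fun i => ∑ y ∈ N i, marginal Ω i y ^ 2 with hc
  set H : ι → ℝ := fun i => -∑ y ∈ N i, marginal Ω i y * log (marginal Ω i y) with hH
  have hcT : ∀ i, ∑ y ∈ T, marginal Ω i y ^ 2 = c i := fun i =>
    (Finset.sum_subset (hNT i) fun y hy h => by simp [hsupp i y hy h]).symm
  have hHT : ∀ i, -∑ y ∈ T, marginal Ω i y * log (marginal Ω i y) = H i := fun i => by
    rw [hH]
    exact congrArg _ (Finset.sum_subset (hNT i) fun y hy h => by simp [hsupp i y hy h]).symm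
  have hcd : ∀ i, 1 / ((N i).card : ℝ) ≤ c i := fun i => by
    have := sq_sum_le_card_mul_sum_sq (s := N i) (f := marginal Ω i)
    rw [hp1 i, one_pow] at this
    rw [div_le_iff₀ (by linarith [hd1 i])]
    linarith
  have hδβ : 1 - 1 / (δ : ℝ) ≠ 0 := by
    have : 1 / (δ : ℝ) < 1 := (div_lt_one (by linarith)).2 hδ1
    linarith
  -- `L B` is `#Ω` times the entropy of the restriction of a random member of `Ω` to `B`.
  set L : Finset ι → ℝ := fun B => ∑ m ∈ Ω, (log Ω.card - log (agreeOn Ω B m).card) with hL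
  set I : ℝ → ℝ → ℝ := fun u s => -((1 - s * u) * log (1 - s * u)) / u - s with hI
  set J : ℝ → ℝ → ℝ := fun d s => -s / (d - 1) - d * log (d - s * (d - 1)) / (d - 1) ^ 2 with hJ
  -- A primitive of the bound on the derivative of `s ↦ bernoulliMean univ s L`.
  set K : ℝ → ℝ := fun s => Ω.card * (s * ∑ i, H i + ((Fintype.card ι) * I α s +
    T.card * (I (1 - 1 / δ) s - I 1 s)) +
    ∑ i, (c i - 1 / (N i).card) * ((N i).card * J (N i).card s)) with hK
  have hJpos : ∀ i, ∀ s : ℝ, s ≤ 1 → 0 < ((N i).card : ℝ) - s * ((N i).card - 1) := by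
    intro i s hs
    nlinarith [hd1 i]
  have hKd : ∀ s, 0 < s → s < 1 → HasDerivAt K (Ω.card * (∑ i, H i +
      ((Fintype.card ι) * log (1 - s * α) + T.card * (log (1 - s * (1 - 1 / δ)) - log (1 - s * 1)))
      + ∑ i, (c i - 1 / (N i).card) * ((N i).card * (s / ((N i).card - s * ((N i).card - 1))))))
      s := by
    intro s h0 h1
    have hsα : s * α ≤ s := by nlinarith
    have hsδ : s * (1 - 1 / δ) ≤ s := by
      have : 0 ≤ s * (1 / (δ : ℝ)) := by positivity
      linarith
    refine HasDerivAt.const_mul _ ((HasDerivAt.add ?_ (HasDerivAt.add ?_ ?_)).add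
      (HasDerivAt.fun_sum fun i _ => ?_))
    · simpa using (hasDerivAt_id s).mul_const (∑ i, H i)
    · exact (hasDerivAt_log_primitive hα0.ne' (by linarith)).const_mul _
    · exact ((hasDerivAt_log_primitive hδβ (by linarith)).sub
        (hasDerivAt_log_primitive one_ne_zero (by linarith))).const_mul _
    · exact ((hasDerivAt_ratio_primitive (hd1 i).ne' (hJpos i s h1.le)).const_mul _).const_mul _
  have hKc : ContinuousOn K (Set.Icc 0 1) := by
    refine ContinuousOn.mul continuousOn_const ((ContinuousOn.add (by fun_prop)
      (Continuous.continuousOn ?_)).add (continuousOn_finsetSum _ fun i _ => ?_))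
    · exact ((continuous_log_primitive α).const_mul _).add
        (((continuous_log_primitive _).sub (continuous_log_primitive 1)).const_mul _)
    · exact fun s hs => (((hasDerivAt_ratio_primitive (hd1 i).ne' (hJpos i s hs.2)).const_mul
        _).const_mul _).continuousAt.continuousWithinAt
  have hF := hasDerivAt_bernoulliMean Finset.univ L
  have hdiff : ∀ x (B : Finset ι), L (insert x B) - L B = ∑ m ∈ Ω,
      (log (agreeOn Ω B m).card - log (agreeOn Ω (insert x B) m).card) := by
    intro x B
    rw [hL, ← Finset.sum_sub_distrib]
    exact Finset.sum_congr rfl fun m _ => by ring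
  have key := le_of_hasDerivAt_nonpos
    (f := fun s => bernoulliMean Finset.univ s L - K s)
    (ContinuousOn.sub (fun s _ => (hF s).continuousAt.continuousWithinAt) hKc)
    (fun s h0 h1 => (hF s).sub (hKd s h0 h1))
    (fun s h0 h1 => by
      have hsα : s * α ≤ s := by nlinarith
      have hse : 0 ≤ s * (1 / (δ : ℝ)) := by positivity
      simp only [hdiff]
      refine sub_nonpos.2 ((sum_bernoulliMean_log_agreeOn_le hΩ hinj hT h0.le h1.le hlα
        (e := 1 / δ) (by linarith)).trans (mul_le_mul_of_nonneg_left ?_ hΩ0.le))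
      simp only [hcT, hHT]
      have h2 := mul_log_one_sub_le hT0.le hlα hα1 h0 h1 (e := 1 / δ) (by positivity)
      have h3 := Finset.sum_le_sum fun i (_ : i ∈ Finset.univ) =>
        collision_mul_le h0 h1 hα1 (hd1 i) (hde i) (hcd i)
      linarith)
  have hL0 : L ∅ = 0 := by
    refine Finset.sum_eq_zero fun m _ => ?_
    simp [agreeOn]
  have hL1 : L Finset.univ = Ω.card * log Ω.card := by
    rw [hL, ← nsmul_eq_mul, ← Finset.sum_const]
    refine Finset.sum_congr rfl fun m hm => ?_
    have : agreeOn Ω Finset.univ m = {m} := by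
      ext m'
      simp only [agreeOn, Finset.mem_filter, Finset.mem_univ, true_implies, Finset.mem_singleton]
      exact ⟨fun h => funext h.2, fun h => by subst h; exact ⟨hm, fun _ => rfl⟩⟩
    rw [this]
    simp
  simp only [bernoulliMean_zero, bernoulliMean_one, hL0, hL1] at key
  have hK1 : K 1 - K 0 = Ω.card * (∑ i, H i + T.card * (-((1 - α) * log (1 - α)) - α +
      log δ / (δ - 1)) + ∑ i, (c i - 1 / (N i).card) * ((N i).card *
        (((N i).card * log (N i).card - (N i).card + 1) / ((N i).card - 1) ^ 2))) := by
    have hIα : (Fintype.card ι) * (I α 1 - I α 0) = T.card * (-((1 - α) * log (1 - α)) - α) := by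
      rw [hlα]
      simp only [hI, one_mul, zero_mul, sub_zero, log_one, mul_zero, neg_zero, zero_div]
      have := mul_div_cancel₀ (-((1 - α) * log (1 - α))) hα0.ne'
      linear_combination (T.card : ℝ) * this
    have hIδ : I (1 - 1 / δ) 1 - I (1 - 1 / δ) 0 - (I 1 1 - I 1 0) = log δ / (δ - 1) := by
      have : (δ : ℝ) - 1 ≠ 0 := by linarith
      simp only [hI]
      simp
      have h3 : 1 - (δ : ℝ)⁻¹ = (δ - 1) / δ := by field_simp
      rw [h3]
      field_simp
    have hJd : ∀ i, J (N i).card 1 - J (N i).card 0 =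
        ((N i).card * log (N i).card - (N i).card + 1) / ((N i).card - 1) ^ 2 := by
      intro i
      have : ((N i).card : ℝ) - 1 ≠ 0 := by linarith [hd1 i]
      simp only [hJ]
      simp
      field_simp
      ring
    have hJs : ∑ i, (c i - 1 / (N i).card) * ((N i).card *
        (((N i).card * log (N i).card - (N i).card + 1) / ((N i).card - 1) ^ 2)) =
        ∑ i, (c i - 1 / (N i).card) * ((N i).card * J (N i).card 1) -
        ∑ i, (c i - 1 / (N i).card) * ((N i).card * J (N i).card 0) := by
      rw [← Finset.sum_sub_distrib]
      exact Finset.sum_congr rfl fun i _ => by rw [← hJd i]; ring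
    rw [hJs]
    simp only [hK]
    linear_combination (Ω.card : ℝ) * hIα + (Ω.card : ℝ) * T.card * hIδ
  have hmain : log Ω.card ≤ ∑ i, H i + T.card * (-((1 - α) * log (1 - α)) - α +
      log δ / (δ - 1)) + ∑ i, (c i - 1 / (N i).card) * ((N i).card *
        (((N i).card * log (N i).card - (N i).card + 1) / ((N i).card - 1) ^ 2)) := by
    refine le_of_mul_le_mul_left ?_ hΩ0
    rw [← hK1]
    linarith
  have hent := Finset.sum_le_sum fun i (_ : i ∈ Finset.univ) =>
    entropy_add_collision_le (N i) (marginal Ω i) (by exact_mod_cast hd1 i)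
      (fun y _ => marginal_nonneg Ω i y) (hp1 i)
  rw [Finset.sum_add_distrib] at hent
  linarith

end Injections

/-! ### Counting partial injections -/

section PartialInjections

open Real

variable {V : Type*} [DecidableEq V]

/-- The extended real `logRatio δ` in nats, as a real number. It has this meaning only for `δ ≥ 1`:
the value `⊤` of `logRatio 0` is not real. -/
noncomputable def natLogRatio (δ : ℕ) : ℝ := if δ = 1 then 1 else log δ / (δ - 1)

lemma natLogRatio_nonneg {δ : ℕ} (hδ : 1 ≤ δ) : 0 ≤ natLogRatio δ := by
  unfold natLogRatio
  split_ifs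
  · exact zero_le_one
  · have : (1 : ℝ) ≤ δ := by exact_mod_cast hδ
    exact div_nonneg (log_nonneg this) (by linarith)

/-- The factor by which the number of partial injections of density `α` into a set of `n` points
can exceed the sum of the products of degrees. -/
noncomputable def densityFactor (n δ : ℕ) (α : ℝ) : ℝ :=
  exp (n * (-((1 - α) * log (1 - α)) - α + natLogRatio δ))

/-- The exponential form of `log_card_injections_le`, with its degenerate cases: for an empty index
type, and for `δ = 1`, the density factor is at least `1`, and the product of the degrees is already
an upper bound. -/
lemma card_injections_le {ι : Type*} [Fintype ι] [DecidableEq ι] {Ω : Finset (ι → V)}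
    (hinj : ∀ m ∈ Ω, Function.Injective m) {T : Finset V} {N : ι → Finset V}
    (hNT : ∀ i, N i ⊆ T) (hΩN : ∀ m ∈ Ω, ∀ i, m i ∈ N i) {δ : ℕ} (hδ : 1 ≤ δ)
    (hd : ∀ i, δ ≤ (N i).card) {α : ℝ} (hα : α = Fintype.card ι / T.card) :
    (Ω.card : ℝ) ≤ densityFactor T.card δ α * ∏ i, ((N i).card : ℝ) := by
  rcases Ω.eq_empty_or_nonempty with h | hΩ
  · rw [h, Finset.card_empty, Nat.cast_zero, densityFactor]
    positivity
  have hprod : (Ω.card : ℝ) ≤ ∏ i, ((N i).card : ℝ) := by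
    have := Finset.card_le_card fun m hm => Fintype.mem_piFinset.2 (hΩN m hm)
    rw [Fintype.card_piFinset] at this
    exact_mod_cast this
  have hΩ0 : (0 : ℝ) < Ω.card := by exact_mod_cast hΩ.card_pos
  have htriv : 1 ≤ densityFactor T.card δ α → (Ω.card : ℝ) ≤
      densityFactor T.card δ α * ∏ i, ((N i).card : ℝ) := fun h => by nlinarith
  rcases Nat.eq_zero_or_pos (Fintype.card ι) with hι | hι
  · refine htriv (one_le_exp ?_)
    rw [hα, hι]
    have := natLogRatio_nonneg hδ
    simp
    positivity
  have hle : (Fintype.card ι : ℝ) ≤ T.card := by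
    obtain ⟨m, hm⟩ := hΩ
    exact_mod_cast Finset.card_le_card_of_injOn (s := Finset.univ) m
      (fun i _ => hNT i (hΩN m hm i)) (hinj m hm).injOn
  have hα0 : 0 ≤ α := by rw [hα]; positivity
  have hα1 : α ≤ 1 := by rw [hα]; exact div_le_one_of_le₀ hle (Nat.cast_nonneg _)
  rcases hδ.eq_or_lt with h1 | h2
  · refine htriv (one_le_exp ?_)
    have : (1 - α) * log (1 - α) ≤ 0 :=
      mul_nonpos_of_nonneg_of_nonpos (by linarith) (log_nonpos (by linarith) (by linarith))
    rw [natLogRatio, if_pos h1.symm]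
    exact mul_nonneg (Nat.cast_nonneg _) (by linarith)
  have hN0 : ∀ i ∈ Finset.univ, ((N i).card : ℝ) ≠ 0 := fun i _ => by
    have := hd i
    exact_mod_cast (by omega : (N i).card ≠ 0)
  have key := log_card_injections_le hΩ hinj hNT hΩN h2 hd hι hα
  rw [← log_prod hN0, log_le_iff_le_exp hΩ0, exp_add, exp_log
    (Finset.prod_pos fun i hi => (Nat.cast_nonneg _).lt_of_ne' (hN0 i hi))] at key
  rw [densityFactor, natLogRatio, if_neg (by omega), mul_comm]
  exact key

variable [Fintype V]

open Classical in
/-- The partial injections of size `l` with domain in `X` that send each `v` into `N v`, each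
encoded by its graph. -/
noncomputable def partialInjections (X : Finset V) (N : V → Finset V) (l : ℕ) :
    Finset (Finset (V × V)) :=
  ((X ×ˢ Finset.univ).powersetCard l).filter fun R =>
    (∀ a ∈ R, a.2 ∈ N a.1) ∧ (∀ a ∈ R, ∀ b ∈ R, a.1 = b.1 → a = b) ∧
      ∀ a ∈ R, ∀ b ∈ R, a.2 = b.2 → a = b

lemma mem_partialInjections {X : Finset V} {N : V → Finset V} {l : ℕ} {R : Finset (V × V)} :
    R ∈ partialInjections X N l ↔ R.card = l ∧ (∀ a ∈ R, a.1 ∈ X ∧ a.2 ∈ N a.1) ∧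
      (∀ a ∈ R, ∀ b ∈ R, a.1 = b.1 → a = b) ∧ ∀ a ∈ R, ∀ b ∈ R, a.2 = b.2 → a = b := by
  simp only [partialInjections, Finset.mem_filter, Finset.mem_powersetCard, Finset.subset_iff,
    Finset.mem_product, Finset.mem_univ, and_true]
  exact ⟨fun ⟨⟨h1, h2⟩, h3, h4⟩ => ⟨h2, fun a ha => ⟨h1 ha, h3 a ha⟩, h4⟩,
    fun ⟨h1, h2, h4⟩ => ⟨⟨fun a ha => (h2 a ha).1, h1⟩, fun a ha => (h2 a ha).2, h4⟩⟩

open Classical in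
/-- A partial injection is determined by its domain `S` and the function on `S` that it is. -/
lemma card_partialInjections_le_sum_injections (X : Finset V) (N : V → Finset V) (l : ℕ) :
    (partialInjections X N l).card ≤ ∑ S ∈ X.powersetCard l,
      ((Fintype.piFinset fun v : S => N v).filter Function.Injective).card := by
  set Ω : (S : Finset V) → Finset (S → V) := fun S =>
    (Fintype.piFinset fun v : S => N v).filter Function.Injective with hΩ
  have hsub : partialInjections X N l ⊆ (X.powersetCard l).biUnion fun S =>
      (Ω S).image fun m => Finset.univ.image fun v : S => ((v : V), m v) := by
    intro R hR
    obtain ⟨hR6, hR2, hR3, hR4⟩ := mem_partialInjections.1 hR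
    have hex : ∀ v : R.image Prod.fst, ∃ w, ((v : V), w) ∈ R := fun v => by
      obtain ⟨a, ha, hav⟩ := Finset.mem_image.1 v.2
      exact ⟨a.2, by rwa [← hav]⟩
    choose m hm using hex
    simp only [Finset.mem_biUnion, Finset.mem_image, Finset.mem_powersetCard]
    refine ⟨R.image Prod.fst, ⟨?_, ?_⟩, m, ?_, ?_⟩
    · exact Finset.image_subset_iff.2 fun a ha => (hR2 a ha).1
    · rw [Finset.card_image_of_injOn fun a ha b hb h => hR3 a ha b hb h, hR6]
    · refine Finset.mem_filter.2 ⟨Fintype.mem_piFinset.2 fun v => (hR2 _ (hm v)).2,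
        fun v w h => ?_⟩
      exact Subtype.ext (congrArg Prod.fst (hR4 _ (hm v) _ (hm w) h))
    · ext a
      simp only [Finset.mem_image, Finset.mem_univ, true_and]
      constructor
      · rintro ⟨v, rfl⟩; exact hm v
      · intro ha
        have hv : a.1 ∈ R.image Prod.fst := Finset.mem_image_of_mem _ ha
        exact ⟨⟨a.1, hv⟩, hR3 _ (hm ⟨a.1, hv⟩) _ ha rfl⟩
  exact (Finset.card_le_card hsub).trans (Finset.card_biUnion_le.trans
    (Finset.sum_le_sum fun S _ => Finset.card_image_le))

lemma card_partialInjections_le_sum_prod (X : Finset V) (N : V → Finset V) (l : ℕ) :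
    (partialInjections X N l).card ≤ ∑ S ∈ X.powersetCard l, ∏ v ∈ S, (N v).card := by
  classical
  refine (card_partialInjections_le_sum_injections X N l).trans (Finset.sum_le_sum fun S _ => ?_)
  refine (Finset.card_filter_le _ _).trans (le_of_eq ?_)
  rw [Fintype.card_piFinset, Finset.prod_coe_sort S fun v => (N v).card]

/-- The entropy bound, summed over the domains `S` of the partial injections. -/
lemma card_partialInjections_le {X T : Finset V} {N : V → Finset V}
    (hNT : ∀ v ∈ X, N v ⊆ T) {δ : ℕ} (hδ : 1 ≤ δ) (hd : ∀ v ∈ X, δ ≤ (N v).card) {l : ℕ} {α : ℝ}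
    (hα : α = l / T.card) :
    ((partialInjections X N l).card : ℝ) ≤
      densityFactor T.card δ α * ∑ S ∈ X.powersetCard l, ∏ v ∈ S, ((N v).card : ℝ) := by
  classical
  refine le_trans (Nat.cast_le.2 (card_partialInjections_le_sum_injections X N l)) ?_
  rw [Nat.cast_sum, Finset.mul_sum]
  refine Finset.sum_le_sum fun S hS => ?_
  obtain ⟨hSX, hSl⟩ := Finset.mem_powersetCard.1 hS
  refine (card_injections_le (N := fun v : S => N v)
    (fun m hm => (Finset.mem_filter.1 hm).2) (fun v => hNT v (hSX v.2))
    (fun m hm => Fintype.mem_piFinset.1 (Finset.mem_filter.1 hm).1) hδ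
    (fun v => hd v (hSX v.2)) (α := α) (by simp [hα, hSl])).trans (le_of_eq ?_)
  rw [Finset.prod_coe_sort S fun v => ((N v).card : ℝ)]

end PartialInjections

/-! ### Two-colouring of two involutions -/

section TwoColouring

/-- Two fixed-point-free involutions `a` and `b` have a common proper 2-colouring: `a` has no fixed
point on the set of orbits of `a * b`, and `b` acts on these orbits as `a` does. -/
lemma exists_colouring_of_involutive {β : Type*} (a b : Equiv.Perm β) (ha : ∀ x, a (a x) = x)
    (hb : ∀ x, b (b x) = x) (ha' : ∀ x, a x ≠ x) (hb' : ∀ x, b x ≠ x) :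
    ∃ c : β → Prop, (∀ x, c (a x) ↔ ¬ c x) ∧ ∀ x, c (b x) ↔ ¬ c x := by
  classical
  set π : Equiv.Perm β := a * b with hπ
  have hinv : a * π * a⁻¹ = π⁻¹ := by
    ext x
    rw [Equiv.Perm.eq_inv_iff_eq]
    simp [hπ, ha, hb]
  have hconj : ∀ (j : ℤ) x, a ((π ^ j) x) = (π ^ (-j)) (a x) := by
    intro j x
    have h : a * π ^ j = π ^ (-j) * a := by
      rw [zpow_neg, ← inv_zpow, ← hinv, conj_zpow]
      group
    exact DFunLike.congr_fun h x
  have hne : ∀ x, ¬ π.SameCycle x (a x) := by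
    rintro x ⟨k, hk⟩
    rcases Int.even_or_odd' k with ⟨j, rfl | rfl⟩
    · refine ha' ((π ^ j) x) ?_
      rw [hconj, ← hk, ← Equiv.Perm.mul_apply, ← zpow_add]
      congr 2
      ring
    · refine hb' ((π ^ j) x) (a.injective ?_)
      have h1 : (π ^ (-j)) ((π ^ (2 * j + 1)) x) = (π ^ (1 + j)) x := by
        rw [← Equiv.Perm.mul_apply, ← zpow_add]
        congr 2
        ring
      rw [hconj, ← hk, h1, zpow_one_add]
      rfl
  -- Of the two orbits that `a` exchanges, the smaller one in some linear order gets one colour.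
  let Q := Quotient (Equiv.Perm.SameCycle.setoid π)
  let _ : LinearOrder Q := linearOrderOfSTO WellOrderingRel
  let r : β → Q := fun x => Quotient.mk _ x
  have hr : ∀ x, r (π x) = r x := fun x =>
    Quotient.sound (⟨-1, by simp⟩ : π.SameCycle (π x) x)
  have hra : ∀ x, r x ≠ r (a x) := fun x h => hne x (Quotient.exact h)
  have hrb : ∀ x, r (b x) = r (a x) := fun x => by
    rw [← hr (b x)]
    simp [hπ, hb]
  have hrab : ∀ x, r (a (b x)) = r x := fun x => hr x
  refine ⟨fun x => r x < r (a x), fun x => ?_, fun x => ?_⟩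
  · beta_reduce
    rw [ha, not_lt]
    exact ⟨le_of_lt, fun h => lt_of_le_of_ne h (hra x).symm⟩
  · beta_reduce
    rw [hrab, hrb, not_lt]
    exact ⟨le_of_lt, fun h => lt_of_le_of_ne h (hra x).symm⟩

end TwoColouring

/-! ### Matchings as partial injections -/

namespace SimpleGraph

variable {V : Type*}

/-- `M` is a set of pairwise vertex-disjoint edges of `G`. -/
def IsEdgeMatching (G : SimpleGraph V) (M : Finset (Sym2 V)) : Prop :=
  (M : Set (Sym2 V)) ⊆ G.edgeSet ∧ ∀ e ∈ M, ∀ f ∈ M, e ≠ f → ∀ v : V, v ∈ e → v ∉ f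

variable {G : SimpleGraph V} {M M' : Finset (Sym2 V)}

lemma IsEdgeMatching.adj (hM : G.IsEdgeMatching M) {u v : V} (h : s(u, v) ∈ M) : G.Adj u v :=
  G.mem_edgeSet.1 (hM.1 h)

lemma IsEdgeMatching.eq_of_mem (hM : G.IsEdgeMatching M) {u v w : V} (hv : s(u, v) ∈ M)
    (hw : s(u, w) ∈ M) : v = w := by
  by_contra hne
  exact hM.2 _ hv _ hw (fun h => hne (Sym2.congr_right.1 h)) u (Sym2.mem_mk_left u v)
    (Sym2.mem_mk_left u w)

/-- The involution that swaps the ends of the edges of a matching, made fixed-point-free by passing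
to two copies of the vertex set and exchanging the copies of an uncovered vertex. -/
lemma IsEdgeMatching.exists_involution (hM : G.IsEdgeMatching M) :
    ∃ a : Equiv.Perm (V × Bool), (∀ x, a (a x) = x) ∧ (∀ x, a x ≠ x) ∧
      ∀ u v, s(u, v) ∈ M → a (u, true) = (v, true) := by
  classical
  let f : V × Bool → V × Bool := fun x =>
    if h : ∃ w, s(x.1, w) ∈ M then (h.choose, x.2) else (x.1, !x.2)
  have hf : ∀ u v i, s(u, v) ∈ M → f (u, i) = (v, i) := by
    intro u v i h
    have hex : ∃ w, s(u, w) ∈ M := ⟨v, h⟩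
    simp only [f, dif_pos hex]
    rw [hM.eq_of_mem hex.choose_spec h]
  have hf' : ∀ u i, (¬ ∃ w, s(u, w) ∈ M) → f (u, i) = (u, !i) := by
    intro u i h
    simp only [f, dif_neg h]
  have hinv : Function.Involutive f := by
    rintro ⟨u, i⟩
    by_cases h : ∃ w, s(u, w) ∈ M
    · obtain ⟨w, hw⟩ := h
      rw [hf u w i hw, hf w u i (by rwa [Sym2.eq_swap])]
    · rw [hf' u i h, hf' u _ h, Bool.not_not]
  refine ⟨hinv.toPerm, hinv, ?_, fun u v h => hf u v true h⟩
  rintro ⟨u, i⟩ heq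
  change f (u, i) = (u, i) at heq
  by_cases h : ∃ w, s(u, w) ∈ M
  · obtain ⟨w, hw⟩ := h
    rw [hf u w i hw] at heq
    exact (hM.adj hw).ne (congrArg Prod.fst heq).symm
  · rw [hf' u i h] at heq
    simpa using congrArg Prod.snd heq

/-- The edges in `M` all have exactly one end in `A`. -/
def Separates (A : Finset V) (M : Finset (Sym2 V)) : Prop :=
  ∀ u v, s(u, v) ∈ M → (u ∈ A ↔ v ∉ A)

lemma Separates.mono {A : Finset V} (h : Separates A M') (hM : M ⊆ M') : Separates A M :=
  fun u v huv => h u v (hM huv)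

/-- The union of two matchings is bipartite. -/
lemma IsEdgeMatching.exists_separates_union [Fintype V] [DecidableEq V] (hM : G.IsEdgeMatching M)
    (hM' : G.IsEdgeMatching M') : ∃ A : Finset V, Separates A (M ∪ M') := by
  classical
  obtain ⟨a, ha, ha', haM⟩ := hM.exists_involution
  obtain ⟨b, hb, hb', hbM⟩ := hM'.exists_involution
  obtain ⟨c, hca, hcb⟩ := exists_colouring_of_involutive a b ha hb ha' hb'
  refine ⟨Finset.univ.filter fun v => c (v, true), fun u v huv => ?_⟩
  simp only [Finset.mem_filter, Finset.mem_univ, true_and]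
  rcases Finset.mem_union.1 huv with h | h
  · rw [← haM u v h, hca, not_not]
  · rw [← hbM u v h, hcb, not_not]

lemma numMatchings_eq_ncard (G : SimpleGraph V) (l : ℕ) :
    G.numMatchings l = {M | G.IsEdgeMatching M ∧ M.card = l}.ncard := by
  unfold numMatchings IsEdgeMatching
  congr 1
  ext M
  simp only [Set.mem_ofPred_eq]
  tauto

variable [Fintype V] [DecidableEq V]

open Classical in
/-- A class of some 2-colouring of the graph with edge set `U`, if there is one. -/
noncomputable def colourClass (U : Finset (Sym2 V)) : Finset V :=
  if h : ∃ A, Separates A U then h.choose else ∅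

lemma IsEdgeMatching.separates_colourClass (hM : G.IsEdgeMatching M) (hM' : G.IsEdgeMatching M') :
    Separates (colourClass (M ∪ M')) (M ∪ M') := by
  have h := hM.exists_separates_union hM'
  rw [colourClass, dif_pos h]
  exact h.choose_spec

/-- The edges in `M`, directed out of `A`. -/
def arcsFrom (A : Finset V) (M : Finset (Sym2 V)) : Finset (V × V) :=
  Finset.univ.filter fun a => a.1 ∈ A ∧ s(a.1, a.2) ∈ M

lemma mem_arcsFrom {A : Finset V} {a : V × V} :
    a ∈ arcsFrom A M ↔ a.1 ∈ A ∧ s(a.1, a.2) ∈ M := by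
  simp [arcsFrom]

lemma image_arcsFrom {A : Finset V} (hA : Separates A M) :
    (arcsFrom A M).image (fun a => s(a.1, a.2)) = M := by
  ext e
  simp only [Finset.mem_image, mem_arcsFrom]
  constructor
  · rintro ⟨a, ⟨_, h⟩, rfl⟩; exact h
  · induction e with
    | _ u v =>
      intro h
      by_cases hu : u ∈ A
      · exact ⟨(u, v), ⟨hu, h⟩, rfl⟩
      · refine ⟨(v, u), ⟨?_, ?_⟩, Sym2.eq_swap⟩
        · by_contra hv
          exact hu ((hA u v h).2 hv)
        · rwa [Sym2.eq_swap]

lemma card_arcsFrom {A : Finset V} (hA : Separates A M) : (arcsFrom A M).card = M.card := by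
  rw [← Finset.card_image_of_injOn (f := fun a : V × V => s(a.1, a.2)) (s := arcsFrom A M),
    image_arcsFrom hA]
  rintro ⟨u, v⟩ h ⟨u', v'⟩ h' heq
  have h1 := mem_arcsFrom.1 (Finset.mem_coe.1 h)
  have h2 := mem_arcsFrom.1 (Finset.mem_coe.1 h')
  rcases Sym2.eq_iff.1 heq with ⟨rfl, rfl⟩ | ⟨h3, h4⟩
  · rfl
  · simp only at h1 h2 h3 h4
    exact absurd h2.1 (h4 ▸ (hA u v h1.2).1 h1.1)

lemma IsEdgeMatching.eq_of_fst (hM : G.IsEdgeMatching M) {A : Finset V} :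
    ∀ a ∈ arcsFrom A M, ∀ b ∈ arcsFrom A M, a.1 = b.1 → a = b := by
  rintro ⟨u, v⟩ h ⟨u', v'⟩ h' (rfl : u = u')
  exact congrArg _ (hM.eq_of_mem (mem_arcsFrom.1 h).2 (mem_arcsFrom.1 h').2)

lemma IsEdgeMatching.eq_of_snd (hM : G.IsEdgeMatching M) {A : Finset V} :
    ∀ a ∈ arcsFrom A M, ∀ b ∈ arcsFrom A M, a.2 = b.2 → a = b := by
  rintro ⟨u, v⟩ h ⟨u', v'⟩ h' (rfl : v = v')
  have h1 := (mem_arcsFrom.1 h).2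
  have h2 := (mem_arcsFrom.1 h').2
  rw [Sym2.eq_swap] at h1 h2
  exact congrArg (·, v) (hM.eq_of_mem h1 h2)

variable [DecidableRel G.Adj]

lemma numMatchings_le_of_bipartite {X Y : Finset V}
    (hXY : G.IsBipartiteWith (X : Set V) (Y : Set V)) (l : ℕ) :
    G.numMatchings l ≤ (partialInjections X (fun v => G.neighborFinset v) l).card := by
  have hsep : ∀ M, G.IsEdgeMatching M → Separates X M := by
    intro M hM u v h
    have hd := Set.disjoint_left.1 hXY.disjoint
    rcases hXY.mem_of_adj (hM.adj h) with ⟨h1, h2⟩ | ⟨h1, h2⟩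
    · exact ⟨fun _ h3 => hd h3 h2, fun _ => h1⟩
    · exact ⟨fun h3 => absurd h1 (hd h3), fun h3 => absurd h2 h3⟩
  rw [numMatchings_eq_ncard, ← Set.ncard_coe_finset]
  refine Set.ncard_le_ncard_of_injOn (arcsFrom X) ?_ ?_ (Finset.finite_toSet _)
  · rintro M ⟨hM, hMl⟩
    refine Finset.mem_coe.2 (mem_partialInjections.2 ⟨?_, fun a ha => ⟨(mem_arcsFrom.1 ha).1,
      (G.mem_neighborFinset _ _).2 (hM.adj (mem_arcsFrom.1 ha).2)⟩, hM.eq_of_fst, hM.eq_of_snd⟩)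
    rw [card_arcsFrom (hsep M hM), hMl]
  · rintro M ⟨hM, _⟩ M' ⟨hM', _⟩ h
    rw [← image_arcsFrom (hsep M hM), ← image_arcsFrom (hsep M' hM'), h]

lemma Separates.compl {A : Finset V} (h : Separates A M) : Separates Aᶜ M := fun u v huv => by
  have := h u v huv
  simp only [Finset.mem_compl]
  tauto

/-- A pair of matchings with its edges directed, those of the first out of `A` and those of the
second into `A`. -/
def pairArcs (A : Finset V) (M M' : Finset (Sym2 V)) : Finset (V × V) :=
  arcsFrom A M ∪ arcsFrom Aᶜ M'

lemma pairArcs_mem_partialInjections {A : Finset V} (hA : Separates A (M ∪ M'))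
    (hM : G.IsEdgeMatching M) (hM' : G.IsEdgeMatching M') :
    pairArcs A M M' ∈
      partialInjections Finset.univ (fun v => G.neighborFinset v) (M.card + M'.card) := by
  have h1 := hA.mono Finset.subset_union_left
  have h2 := (hA.mono Finset.subset_union_right).compl
  have hfst : ∀ a ∈ arcsFrom A M, ∀ b ∈ arcsFrom Aᶜ M', a.1 ≠ b.1 :=
    fun a ha b hb h => Finset.mem_compl.1 (mem_arcsFrom.1 hb).1 (h ▸ (mem_arcsFrom.1 ha).1)
  have hsnd : ∀ a ∈ arcsFrom A M, ∀ b ∈ arcsFrom Aᶜ M', a.2 ≠ b.2 := by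
    intro a ha b hb h
    have ha' := (h1 _ _ (mem_arcsFrom.1 ha).2).1 (mem_arcsFrom.1 ha).1
    have hb' := (h2 _ _ (mem_arcsFrom.1 hb).2).1 (mem_arcsFrom.1 hb).1
    exact hb' (Finset.mem_compl.2 (h ▸ ha'))
  refine mem_partialInjections.2 ⟨?_, fun a ha => ⟨Finset.mem_univ _, ?_⟩, fun a ha b hb h => ?_,
    fun a ha b hb h => ?_⟩
  · rw [pairArcs, Finset.card_union_of_disjoint
      (Finset.disjoint_left.2 fun a ha hb => hfst a ha a hb rfl), card_arcsFrom h1,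
      card_arcsFrom h2]
  · refine (G.mem_neighborFinset _ _).2 ?_
    rcases Finset.mem_union.1 ha with ha | ha
    · exact hM.adj (mem_arcsFrom.1 ha).2
    · exact hM'.adj (mem_arcsFrom.1 ha).2
  · rcases Finset.mem_union.1 ha with ha | ha <;> rcases Finset.mem_union.1 hb with hb | hb
    · exact hM.eq_of_fst a ha b hb h
    · exact absurd h (hfst a ha b hb)
    · exact absurd h.symm (hfst b hb a ha)
    · exact hM'.eq_of_fst a ha b hb h
  · rcases Finset.mem_union.1 ha with ha | ha <;> rcases Finset.mem_union.1 hb with hb | hb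
    · exact hM.eq_of_snd a ha b hb h
    · exact absurd h (hsnd a ha b hb)
    · exact absurd h.symm (hsnd b hb a ha)
    · exact hM'.eq_of_snd a ha b hb h

lemma image_pairArcs {A : Finset V} (hA : Separates A (M ∪ M')) :
    (pairArcs A M M').image (fun a => s(a.1, a.2)) = M ∪ M' := by
  rw [pairArcs, Finset.image_union, image_arcsFrom (hA.mono Finset.subset_union_left),
    image_arcsFrom (hA.mono Finset.subset_union_right).compl]

lemma filter_mem_pairArcs (A : Finset V) :
    (pairArcs A M M').filter (fun a => a.1 ∈ A) = arcsFrom A M := by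
  ext a
  simp only [pairArcs, Finset.mem_filter, Finset.mem_union, mem_arcsFrom, Finset.mem_compl]
  tauto

lemma filter_notMem_pairArcs (A : Finset V) :
    (pairArcs A M M').filter (fun a => a.1 ∉ A) = arcsFrom Aᶜ M' := by
  ext a
  simp only [pairArcs, Finset.mem_filter, Finset.mem_union, mem_arcsFrom, Finset.mem_compl]
  tauto

/-- A pair of `l`-matchings becomes a partial injection of size `2 l` once the edges of the first
are directed out of one class of a 2-colouring of the union, those of the second out of the other.
The colouring is a function of the union, which the partial injection determines. -/
lemma sq_numMatchings_le (G : SimpleGraph V) [DecidableRel G.Adj] (l : ℕ) :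
    G.numMatchings l ^ 2 ≤
      (partialInjections Finset.univ (fun v => G.neighborFinset v) (2 * l)).card := by
  rw [numMatchings_eq_ncard, pow_two, ← Set.ncard_prod, ← Set.ncard_coe_finset]
  refine Set.ncard_le_ncard_of_injOn (fun P => pairArcs (colourClass (P.1 ∪ P.2)) P.1 P.2) ?_ ?_
    (Finset.finite_toSet _)
  · rintro ⟨M, M'⟩ ⟨⟨hM, hMl⟩, hM', hMl'⟩
    dsimp only at hM hMl hM' hMl'
    have := pairArcs_mem_partialInjections (hM.separates_colourClass hM') hM hM'
    rw [hMl, hMl', ← two_mul] at this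
    exact this
  · rintro ⟨M, M'⟩ ⟨⟨hM, -⟩, hM', -⟩ ⟨L, L'⟩ ⟨⟨hL, -⟩, hL', -⟩ h
    dsimp only at hM hM' hL hL' h
    have hsM := hM.separates_colourClass hM'
    have hsL := hL.separates_colourClass hL'
    have hU : M ∪ M' = L ∪ L' := by rw [← image_pairArcs hsM, h, image_pairArcs hsL]
    have hsL' : Separates (colourClass (M ∪ M')) (L ∪ L') := hU ▸ hsM
    rw [← hU] at h
    have h1 := filter_mem_pairArcs (M := M) (M' := M') (colourClass (M ∪ M'))
    have h2 := filter_notMem_pairArcs (M := M) (M' := M') (colourClass (M ∪ M'))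
    rw [h, filter_mem_pairArcs] at h1
    rw [h, filter_notMem_pairArcs] at h2
    refine Prod.ext ?_ ?_
    · rw [← image_arcsFrom (hsM.mono Finset.subset_union_left), ← h1,
        image_arcsFrom (hsL'.mono Finset.subset_union_left)]
    · rw [← image_arcsFrom (hsM.mono Finset.subset_union_right).compl, ← h2,
        image_arcsFrom (hsL'.mono Finset.subset_union_right).compl]

end SimpleGraph

/-! ### Extended logarithms -/

section ExtendedReals

open Real

lemma logRatio_zero : logRatio 0 = ⊤ := by
  have h : ((((0 : ℕ) : ℝ) - 1 : ℝ) : EReal) < 0 := by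
    rw [← EReal.coe_zero, EReal.coe_lt_coe_iff]
    norm_num
  rw [logRatio, if_neg (by norm_num), extLogTwo, if_pos rfl,
    EReal.bot_div_of_neg_ne_bot h (EReal.coe_ne_bot _)]

lemma logRatio_eq_coe {δ : ℕ} (hδ : 1 ≤ δ) :
    logRatio δ = ((natLogRatio δ / log 2 : ℝ) : EReal) := by
  unfold logRatio natLogRatio
  split_ifs with h1
  · simp [logb]
  · rw [extLogTwo, if_neg (by omega), ← EReal.coe_div, EReal.coe_eq_coe_iff, logb]
    ring

lemma entropyTwo_add_eq (α : ℝ) :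
    entropyTwo α + α * logb 2 (α / exp 1) = (-((1 - α) * log (1 - α)) - α) / log 2 := by
  rcases eq_or_ne α 0 with rfl | h
  · simp [entropyTwo]
  · rw [entropyTwo, logb, binEntropy, log_div h (exp_pos 1).ne', log_exp, log_inv, log_inv]
    ring

/-- Passage from a counting bound to the bound on extended logarithms. When `δ = 0` the right-hand
side is `⊤`, unless `n = 0`. -/
lemma extLogTwo_le_of_pow_le {Φ D n δ k : ℕ} {α : ℝ} (hk : 0 < k) (hD : Φ ≠ 0 → D ≠ 0)
    (hn : n = 0 → Φ ≤ 1) (h : 1 ≤ δ → (Φ : ℝ) ^ k ≤ densityFactor n δ α * D) :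
    extLogTwo Φ ≤ ((1 / k : ℝ) : EReal) * extLogTwo D + ((n / k : ℝ) : EReal) *
      (((entropyTwo α + α * logb 2 (α / exp 1) : ℝ) : EReal) + logRatio δ) := by
  rcases eq_or_ne Φ 0 with hΦ | hΦ
  · rw [extLogTwo, if_pos hΦ]
    exact bot_le
  have hk' : (0 : ℝ) < k := by exact_mod_cast hk
  have hΦ' : (0 : ℝ) < Φ := by exact_mod_cast Nat.pos_of_ne_zero hΦ
  have hD' : (1 : ℝ) ≤ D := by exact_mod_cast Nat.one_le_iff_ne_zero.2 (hD hΦ)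
  rw [extLogTwo, if_neg hΦ, extLogTwo, if_neg (hD hΦ), ← EReal.coe_mul]
  rcases Nat.eq_zero_or_pos n with hn0 | hn0
  · have h1 : Φ = 1 := by have := hn hn0; omega
    rw [hn0, h1, Nat.cast_zero, zero_div, EReal.coe_zero, zero_mul, add_zero, Nat.cast_one,
      logb_one, EReal.coe_le_coe_iff]
    have := logb_nonneg one_lt_two hD'
    positivity
  have hn' : (0 : ℝ) < n / k := div_pos (by exact_mod_cast hn0) hk'
  rcases Nat.eq_zero_or_pos δ with hδ | hδ
  · rw [hδ, logRatio_zero, EReal.coe_add_top, EReal.coe_mul_top_of_pos hn', EReal.coe_add_top]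
    exact le_top
  rw [logRatio_eq_coe hδ, ← EReal.coe_add, ← EReal.coe_mul, ← EReal.coe_add,
    EReal.coe_le_coe_iff, entropyTwo_add_eq, logb, logb]
  have hlog := log_le_log (pow_pos hΦ' k) (h hδ)
  rw [densityFactor, log_pow, log_mul (exp_pos _).ne' (by linarith), log_exp] at hlog
  have h2 : 0 < log 2 := log_pos one_lt_two
  have e : (1 / k : ℝ) * (log D / log 2) + n / k * ((-((1 - α) * log (1 - α)) - α) / log 2 +
      natLogRatio δ / log 2) =
      (n * (-((1 - α) * log (1 - α)) - α + natLogRatio δ) + log D) / k / log 2 := by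
    field_simp
    ring
  rw [e]
  refine div_le_div_of_nonneg_right ?_ h2.le
  rw [le_div_iff₀ hk']
  linarith

end ExtendedReals

/-! ### The bounds on the number of matchings -/

namespace SimpleGraph

lemma numMatchings_zero_le_one {V : Type*} (G : SimpleGraph V) : G.numMatchings 0 ≤ 1 := by
  unfold numMatchings
  refine (Set.ncard_le_ncard (t := {∅}) ?_ (Set.finite_singleton _)).trans
    (Set.ncard_singleton _).le
  rintro M ⟨-, hM, -⟩
  exact Finset.card_eq_zero.1 hM

lemma minDegreeOn_le_degree {V : Type*} [Fintype V] (G : SimpleGraph V) [DecidableRel G.Adj]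
    {X : Finset V} {x : V} (hx : x ∈ X) : G.minDegreeOn X ≤ G.degree x :=
  Nat.sInf_le ⟨x, hx, rfl⟩

end SimpleGraph

theorem theorem2 {V : Type*} [Fintype V] [DecidableEq V]
    (G : SimpleGraph V) [DecidableRel G.Adj] (l : ℕ) :
    (∀ X Y : Finset V, G.IsBipartiteWith (X : Set V) (Y : Set V) → X ∪ Y = Finset.univ →
      l ≤ min X.card Y.card →
      ∀ α : ℝ, α = (l : ℝ) / (Y.card : ℝ) →
        extLogTwo (G.numMatchings l) ≤
          extLogTwo (G.degreeSymm l X) + ((Y.card : ℝ) : EReal) *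
            (((entropyTwo α + α * Real.logb 2 (α / Real.exp 1) : ℝ) : EReal) +
              logRatio (G.minDegreeOn X))) ∧
    (2 * l ≤ Fintype.card V →
      ∀ α : ℝ, α = 2 * (l : ℝ) / (Fintype.card V : ℝ) →
        extLogTwo (G.numMatchings l) ≤
          (((1 : ℝ) / 2 : ℝ) : EReal) * extLogTwo (G.degreeSymm (2 * l) Finset.univ) +
            (((Fintype.card V : ℝ) / 2 : ℝ) : EReal) *
              (((entropyTwo α + α * Real.logb 2 (α / Real.exp 1) : ℝ) : EReal) +
                logRatio G.minDegree)) := by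
  have hdeg : ∀ k (X : Finset V), G.degreeSymm k X =
      ∑ S ∈ X.powersetCard k, ∏ v ∈ S, (G.neighborFinset v).card := fun k X => by
    simp only [SimpleGraph.degreeSymm, SimpleGraph.card_neighborFinset_eq_degree]
  constructor
  · intro X Y hXY _ hl α hα
    have hle := SimpleGraph.numMatchings_le_of_bipartite hXY l
    have key := extLogTwo_le_of_pow_le (Φ := G.numMatchings l) (D := G.degreeSymm l X)
      (n := Y.card) (δ := G.minDegreeOn X) (k := 1) (α := α) one_pos ?_ ?_ ?_
    · simpa using key
    -- A matching exists only if some product of degrees is nonzero, also when `δ = 0`.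
    · intro hΦ
      have := hle.trans (card_partialInjections_le_sum_prod X _ l)
      rw [← hdeg] at this
      omega
    -- With `Y` empty the bracket, which may be `⊤`, is multiplied by `0`.
    · intro hY
      rw [show l = 0 by omega]
      exact G.numMatchings_zero_le_one
    · intro hδ
      have := card_partialInjections_le (X := X) (T := Y) (N := fun v => G.neighborFinset v)
        (fun v hv => SimpleGraph.isBipartiteWith_neighborFinset_subset hXY hv) hδ
        (fun v hv => by
          rw [SimpleGraph.card_neighborFinset_eq_degree]
          exact G.minDegreeOn_le_degree hv) hα
      rw [pow_one, hdeg]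
      push_cast
      exact (Nat.cast_le.2 hle).trans this
  · intro hl α hα
    have hle := SimpleGraph.sq_numMatchings_le G l
    have key := extLogTwo_le_of_pow_le (Φ := G.numMatchings l)
      (D := G.degreeSymm (2 * l) Finset.univ)
      (n := Fintype.card V) (δ := G.minDegree) (k := 2) (α := α) two_pos ?_ ?_ ?_
    · exact_mod_cast key
    · intro hΦ
      have := hle.trans (card_partialInjections_le_sum_prod Finset.univ _ (2 * l))
      rw [← hdeg] at this
      have : 0 < G.numMatchings l ^ 2 := by positivity
      omega
    · intro hV
      rw [show l = 0 by omega]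
      exact G.numMatchings_zero_le_one
    · intro hδ
      have := card_partialInjections_le (X := Finset.univ) (T := Finset.univ)
        (N := fun v => G.neighborFinset v) (fun v _ => Finset.subset_univ _) hδ
        (fun v _ => by
          rw [SimpleGraph.card_neighborFinset_eq_degree]
          exact G.minDegree_le_degree v) (l := 2 * l) (α := α)
          (by rw [hα, Finset.card_univ]; push_cast; rfl)
      rw [Finset.card_univ] at this
      rw [hdeg]
      push_cast
      refine le_trans ?_ this
      exact_mod_cast hle
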